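/- **Setting.** Let $X$ and $\Theta$ be Borel subsets of Polish metric spaces, with $\Theta$ containing at least two points. For a separable metric space $S$, let $\mathcal M(S)$ be the set of Borel probability measures on $S$, with the weak topology and the Prokhorov metric $d_{Pr}$; let $d_{tv}(\mu,\nu)=\sup_A|\mu(A)-\nu(A)|$ over Borel sets $A$. Let $P:\Theta\to\mathcal M(X)$, $\theta\mapsto P_\theta$, be measurable, injective, dominated (there is a $\sigma$-finite $\nu$ with $P_\theta\ll\nu$ for all $\theta$), and such that $P:\Theta\to P(\Theta)$ is open, where $P(\Theta)$ carries the subspace topology. For every prior $\pi\in\mathcal M(\Theta)$ and $n\ge 0$ fix a measurable map $x^n\mapsto\pi_{x^n}$, $X^n\to\mathcal M(\Theta)$, which is a version of the conditional distribution of the parameter given the sample when the parameter has law $\pi$ and the sample given $\theta$ has law $P_\theta^n$. As for posteriors computed by Bayes' rule for densities, assume that for all $\pi$, $n$ and $\theta$, $\pi_{x^n}\ll\pi$ for $P_\theta^n$-almost every $x^n$. For $\mu\in\mathcal M(X)$ let $\pi_*\mu^n\in\mathcal M(\mathcal M(\Theta))$ be the law of $\pi_{x^n}$ for $x^n\sim\mu^n$,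 and let $\pi_n(x^\infty)=\pi_{x^n}$, a random measure on $(X^\infty,\mu^\infty)$. The Ky Fan metric is $\alpha_\mu(Z,W)=\inf\{\epsilon\ge 0:\mu^\infty(d_{Pr}(Z,W)>\epsilon)\le\epsilon\}$. Let $d_{\mathcal M(X)}$ and $d_{\mathcal M^2(\Theta)}$ be arbitrary pseudometrics on $\mathcal M(X)$ and $\mathcal M(\mathcal M(\Theta))$. Bayesian inference is *robust at* $(\epsilon_1,\epsilon_2,\delta_1,\delta_2)$ with respect to $\mathcal Z\subset(\mathcal M(\Theta)\times\mathcal M(X))^2$ if for every $((\pi,\mu),(\pi',\mu'))\in\mathcal Z$ with $d_{tv}(\pi,\pi')<\delta_1$ and $d_{\mathcal M(X)}(\mu,\mu')<\delta_2$ one has, for all large enough $n$, $$d_{\mathcal M^2(\Theta)}(\pi'_*\mu^n,\pi'_*\mu'^n)<\epsilon_1\quad\text{and}\quad \alpha_\mu(\pi_n,\pi'_n)<\epsilon_2 .$$ It is *qualitatively robust* with respect to $\mathcal Z$ if for all $\epsilon_1,\epsilon_2>0$ there are $\delta_1,\delta_2>0$ such that it is robust at $(\epsilon_1,\epsilon_2,\delta_1,\delta_2)$.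 For $\theta\in\Theta$, let $\mathcal K(\theta)$ be the set of priors $\pi$ with $\pi\{\theta':K(P_\theta,P_{\theta'})\le\epsilon\}>0$ for all $\epsilon>0$, where $K$ is the Kullback–Leibler divergence, and for $\rho>0$ let $$\mathcal Z_\rho(\theta)=\{((\pi,P_\theta),(\pi',P_\theta)):\pi\in\mathcal K(\theta),\ \pi'\in\mathcal M(\Theta),\ d_{tv}(\pi,\pi')<\rho\}.$$ **Theorem 4.1.** For every $\theta\in\Theta$ and every $\rho>0$, Bayesian inference is not qualitatively robust with respect to $\mathcal Z_\rho(\theta)$. Moreover, with $D\in[0,\infty]$ the diameter of $\Theta$, for every $\epsilon_1$ and every $\epsilon_2<\min(D/2,1)$ there are no $\delta_1,\delta_2>0$ for which Bayesian inference is robust at $(\epsilon_1,\epsilon_2,\delta_1,\delta_2)$ with respect to $\mathcal Z_\rho(\theta)$. -/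

import Mathlib

open MeasureTheory Filter Topology
open scoped ENNReal

noncomputable section

namespace BayesRobust

universe u v

/-- `d` satisfies the axioms of a pseudometric on `α`. -/
structure IsPseudometric {α : Type*} (d : α → α → ℝ) : Prop where
  nonneg : ∀ a b, 0 ≤ d a b
  self : ∀ a, d a a = 0
  symm : ∀ a b, d a b = d b a
  triangle : ∀ a b c, d a c ≤ d a b + d b c

/-- The total variation distance `sup_A |μ(A) - ν(A)|`, over measurable `A`. -/
def tvDist {S : Type*} [MeasurableSpace S] (μ ν : ProbabilityMeasure S) : ℝ :=
  ⨆ A : {A : Set S // MeasurableSet A}, |(μ : Measure S).real A.1 - (ν : Measure S).real A.1|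

/-- The Prokhorov distance between two Borel probability measures on a metric space. -/
def prokhorovDist {S : Type*} [MetricSpace S] [MeasurableSpace S]
    (μ ν : ProbabilityMeasure S) : ℝ :=
  levyProkhorovDist (μ : Measure S) (ν : Measure S)

/-- The law `μ ^ n` of an i.i.d. sample of size `n` from `μ`. -/
def iid {X : Type*} [MeasurableSpace X] (μ : ProbabilityMeasure X) (n : ℕ) :
    ProbabilityMeasure (Fin n → X) :=
  ⟨Measure.pi fun _ => (μ : Measure X), inferInstance⟩

/-- The law `μ ^ ∞` of an infinite i.i.d. sample from `μ`. -/
def iidInf {X : Type*} [MeasurableSpace X] (μ : ProbabilityMeasure X) :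
    ProbabilityMeasure (ℕ → X) :=
  ⟨Measure.infinitePi fun _ => (μ : Measure X), inferInstance⟩

/-- The Ky Fan distance `inf {ε ≥ 0 : μ^∞ (d_Pr (Z, W) > ε) ≤ ε}` between two random probability
measures `Z` and `W` on `Θ`, defined on the probability space `(X^∞, μ^∞)`. -/
def kyFanDist {Θ X : Type*} [MetricSpace Θ] [MeasurableSpace Θ] [MeasurableSpace X]
    (μ : ProbabilityMeasure X) (Z W : (ℕ → X) → ProbabilityMeasure Θ) : ℝ :=
  sInf {ε : ℝ | 0 ≤ ε ∧
    (iidInf μ : Measure (ℕ → X)) {x | ε < prokhorovDist (Z x) (W x)} ≤ ENNReal.ofReal ε}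

/-- A model is dominated if all its members are absolutely continuous with respect to one
`σ`-finite measure. -/
def IsDominated {Θ X : Type*} [MeasurableSpace X] (P : Θ → ProbabilityMeasure X) : Prop :=
  ∃ ν : Measure X, SigmaFinite ν ∧ ∀ θ, (P θ : Measure X) ≪ ν

/-- The Kullback-Leibler neighbourhood `{θ' : K (P θ, P θ') ≤ ε}` of `θ`. -/
def klNhd {Θ X : Type*} [MeasurableSpace X] (P : Θ → ProbabilityMeasure X) (θ : Θ) (ε : ℝ) :
    Set Θ :=
  {θ' | InformationTheory.klDiv (P θ : Measure X) (P θ' : Measure X) ≤ ENNReal.ofReal ε}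

/-- The set of priors with Kullback-Leibler support at `θ`. -/
def klSupport {Θ X : Type*} [MeasurableSpace Θ] [MeasurableSpace X]
    (P : Θ → ProbabilityMeasure X) (θ : Θ) : Set (ProbabilityMeasure Θ) :=
  {π | ∀ ε : ℝ, 0 < ε → 0 < (π : Measure Θ) (klNhd P θ ε)}

/-- A determination of the posterior distributions of the model `P`: for every prior `π` and sample
size `n`, a version `xⁿ ↦ post π n xⁿ` of the conditional distribution of the parameter given the
sample, when the parameter has law `π` and, given that the parameter is `θ`, the sample has law
`(P θ)^n`.

Such a version is determined only up to null sets of the marginal law of the sample. The last field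
is the property of the versions given by Bayes' rule for densities that fixes what happens there: a
posterior is absolutely continuous with respect to its prior, for almost every sample generated by
any member of the model. -/
structure PosteriorFamily {Θ : Type u} {X : Type v} [MeasurableSpace Θ] [MeasurableSpace X]
    (P : Θ → ProbabilityMeasure X) where
  post : ProbabilityMeasure Θ → (n : ℕ) → (Fin n → X) → ProbabilityMeasure Θ
  measurable_post : ∀ π n, Measurable (post π n)
  isCond : ∀ (π : ProbabilityMeasure Θ) (n : ℕ) (A : Set (Fin n → X)) (B : Set Θ),
    MeasurableSet A → MeasurableSet B →
      ∫⁻ θ, (∫⁻ x in A, (post π n x : Measure Θ) B ∂(iid (P θ) n : Measure (Fin n → X)))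
          ∂(π : Measure Θ) =
        ∫⁻ θ in B, (iid (P θ) n : Measure (Fin n → X)) A ∂(π : Measure Θ)
  absolutelyContinuous : ∀ (π : ProbabilityMeasure Θ) (n : ℕ) (θ : Θ),
    ∀ᵐ x ∂(iid (P θ) n : Measure (Fin n → X)), (post π n x : Measure Θ) ≪ (π : Measure Θ)

namespace PosteriorFamily

variable {Θ : Type u} {X : Type v} [MeasurableSpace Θ] [MeasurableSpace X]
  {P : Θ → ProbabilityMeasure X}

/-- The sampling distribution `π_* μ^n` of the posterior when the sample has law `μ^n`. -/
def law (b : PosteriorFamily P) (π : ProbabilityMeasure Θ) (μ : ProbabilityMeasure X) (n : ℕ) :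
    ProbabilityMeasure (ProbabilityMeasure Θ) :=
  (iid μ n).map (b.measurable_post π n).aemeasurable

/-- The posterior given the first `n` data points, as a random variable on `X^∞`. -/
def rv (b : PosteriorFamily P) (π : ProbabilityMeasure Θ) (n : ℕ) (x : ℕ → X) :
    ProbabilityMeasure Θ :=
  b.post π n fun i => x i

end PosteriorFamily

/-- The robustness requirement for given tolerances `ε₁`, `ε₂` and perturbation sizes `δ₁`, `δ₂`,
with respect to the admissible set `Z` of pairs `((π, μ), (π', μ'))` of prior-data pairs. -/
def RobustAt {Θ : Type u} {X : Type v} [MeasurableSpace Θ] [MeasurableSpace X]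
    {P : Θ → ProbabilityMeasure X} (b : PosteriorFamily P)
    (dPrior : ProbabilityMeasure Θ → ProbabilityMeasure Θ → ℝ)
    (dData : ProbabilityMeasure X → ProbabilityMeasure X → ℝ)
    (dLaw : ProbabilityMeasure (ProbabilityMeasure Θ) →
      ProbabilityMeasure (ProbabilityMeasure Θ) → ℝ)
    (α : ProbabilityMeasure X → ((ℕ → X) → ProbabilityMeasure Θ) →
      ((ℕ → X) → ProbabilityMeasure Θ) → ℝ)
    (Z : Set ((ProbabilityMeasure Θ × ProbabilityMeasure X) ×
      (ProbabilityMeasure Θ × ProbabilityMeasure X)))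
    (ε₁ ε₂ δ₁ δ₂ : ℝ) : Prop :=
  ∀ π μ π' μ', ((π, μ), (π', μ')) ∈ Z → dPrior π π' < δ₁ → dData μ μ' < δ₂ →
    ∀ᶠ n in atTop,
      dLaw (b.law π' μ n) (b.law π' μ' n) < ε₁ ∧ α μ (b.rv π n) (b.rv π' n) < ε₂

/-- Qualitative robustness of Bayesian inference with respect to the admissible set `Z`. -/
def QualitativelyRobust {Θ : Type u} {X : Type v} [MeasurableSpace Θ] [MeasurableSpace X]
    {P : Θ → ProbabilityMeasure X} (b : PosteriorFamily P)
    (dPrior : ProbabilityMeasure Θ → ProbabilityMeasure Θ → ℝ)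
    (dData : ProbabilityMeasure X → ProbabilityMeasure X → ℝ)
    (dLaw : ProbabilityMeasure (ProbabilityMeasure Θ) →
      ProbabilityMeasure (ProbabilityMeasure Θ) → ℝ)
    (α : ProbabilityMeasure X → ((ℕ → X) → ProbabilityMeasure Θ) →
      ((ℕ → X) → ProbabilityMeasure Θ) → ℝ)
    (Z : Set ((ProbabilityMeasure Θ × ProbabilityMeasure X) ×
      (ProbabilityMeasure Θ × ProbabilityMeasure X))) : Prop :=
  ∀ ε₁ ε₂ : ℝ, 0 < ε₁ → 0 < ε₂ → ∃ δ₁ δ₂ : ℝ, 0 < δ₁ ∧ 0 < δ₂ ∧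
    RobustAt b dPrior dData dLaw α Z ε₁ ε₂ δ₁ δ₂

/-- The admissible set `Z_ρ(θ)`: a prior with Kullback-Leibler support at `θ`, a perturbation of it
of size less than `ρ` in total variation, and `P θ` as the unperturbed data distribution of both. -/
def admissible {Θ : Type u} {X : Type v} [MeasurableSpace Θ] [MeasurableSpace X]
    (P : Θ → ProbabilityMeasure X) (θ : Θ) (ρ : ℝ) :
    Set ((ProbabilityMeasure Θ × ProbabilityMeasure X) ×
      (ProbabilityMeasure Θ × ProbabilityMeasure X)) :=
  {z | z.1.1 ∈ klSupport P θ ∧ tvDist z.1.1 z.2.1 < ρ ∧ z.1.2 = P θ ∧ z.2.2 = P θ}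

end BayesRobust

end

/-! A point-mass prior at a wrong parameter never learns, yet an arbitrarily small amount of mass at
the true one makes it consistent. Let the data come from `P θ`, take `θ' ≠ θ`, and perturb `(1 - t)
δ_θ' + t δ_θ` to `δ_θ'`. The total variation distance is at most `t`, and the atom at `θ` puts the
first prior in the Kullback-Leibler class for every `t > 0`. Its posterior concentrates at `θ`,
because a consistent test separates `P θ` from `P θ'` (`tendsto_post_twoPoint`), while the posterior
of `δ_θ'` stays `δ_θ'` (`post_dirac`). So the Ky Fan requirement fails for every tolerance below
`min (d(θ, θ')) 1`. Any tolerance below `D / 2` is exceeded by `d(θ, θ')` for a suitable `θ'`. Both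
data laws equal `P θ`, so the pseudometric on data laws plays no role. -/

namespace BayesRobust

open Set

/-! ### I.i.d. samples and consistent tests -/

section IID

variable {X : Type*} [MeasurableSpace X]

/-- The first `n` coordinates of an infinite i.i.d. sample are an i.i.d. sample of size `n`. -/
lemma measurePreserving_iidInf_iid (μ : ProbabilityMeasure X) (n : ℕ) :
    MeasurePreserving (fun (x : ℕ → X) (i : Fin n) => x i)
      (iidInf μ : Measure (ℕ → X)) (iid μ n : Measure (Fin n → X)) := by
  have hm : Measurable (fun (x : ℕ → X) (i : Fin n) => x i) := by fun_prop
  refine ⟨hm, ?_⟩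
  change Measure.map _ (Measure.infinitePi fun _ => (μ : Measure X)) = Measure.pi _
  rw [← Measure.infinitePi_eq_pi]
  refine Measure.eq_infinitePi _ fun s t ht => ?_
  classical
  rw [Measure.map_apply hm (.pi s.countable_toSet fun i _ => ht i)]
  -- A box in the first `n` coordinates is a box in `X^∞`; the value `univ` is never used, since all
  -- indices in the image of `s` are below `n`.
  have : (fun (x : ℕ → X) (i : Fin n) => x i) ⁻¹' (Set.pi s t) =
      Set.pi (s.map Fin.valEmbedding : Finset ℕ)
        (fun j => if h : j < n then t ⟨j, h⟩ else univ) := by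
    ext x
    simp [Set.mem_pi]
  rw [this, Measure.infinitePi_pi]
  · simp
  · intro i hi
    split_ifs with h
    exacts [ht _, .univ]

/-- The empirical frequency of `A` in a finite sample. -/
noncomputable def empFreq (A : Set X) (n : ℕ) (x : Fin n → X) : ℝ :=
  (∑ i, A.indicator (fun _ => (1 : ℝ)) (x i)) / n

lemma measurable_empFreq {A : Set X} (hA : MeasurableSet A) (n : ℕ) :
    Measurable (empFreq A n) := by
  have : Measurable (A.indicator (fun _ => (1 : ℝ))) := measurable_const.indicator hA
  unfold empFreq
  fun_prop

/-- The weak law of large numbers for empirical frequencies. -/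
lemma tendsto_iid_empFreq (μ : ProbabilityMeasure X) {A : Set X} (hA : MeasurableSet A)
    {r : ℝ} (hr : 0 < r) :
    Tendsto (fun n => (iid μ n : Measure (Fin n → X))
      {x | r ≤ |empFreq A n x - (μ : Measure X).real A|}) atTop (𝓝 0) := by
  set f : X → ℝ := A.indicator fun _ => 1 with hf_def
  have hf : Measurable f := measurable_const.indicator hA
  have hmp (i : ℕ) : MeasurePreserving (fun x : ℕ → X => x i)
      (iidInf μ : Measure (ℕ → X)) (μ : Measure X) :=
    measurePreserving_eval_infinitePi (fun _ : ℕ => (μ : Measure X)) i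
  have hfi : Integrable f (μ : Measure X) := (integrable_const 1).indicator hA
  have hslln := ProbabilityTheory.strong_law_ae_real (μ := (iidInf μ : Measure (ℕ → X)))
    (fun (i : ℕ) x => f (x i)) ((hmp 0).integrable_comp_of_integrable hfi)
    (fun i j hij => (ProbabilityTheory.iIndepFun_infinitePi
      (P := fun _ : ℕ => (μ : Measure X)) (X := fun _ => f) (fun _ => hf)).indepFun hij)
    (fun i => ⟨(hf.comp (hmp i).measurable).aemeasurable,
      (hf.comp (hmp 0).measurable).aemeasurable, by
        change Measure.map (f ∘ fun x : ℕ → X => x i) _ =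
          Measure.map (f ∘ fun x : ℕ → X => x 0) _
        rw [← Measure.map_map hf (hmp i).measurable, ← Measure.map_map hf (hmp 0).measurable,
          (hmp i).map_eq, (hmp 0).map_eq]⟩)
  have hmean : (∫ x, f (x 0) ∂(iidInf μ : Measure (ℕ → X))) = (μ : Measure X).real A := by
    have h := integral_map (hmp 0).aemeasurable
      (hf.aestronglyMeasurable (μ := Measure.map (fun x : ℕ → X => x 0) (iidInf μ)))
    rw [(hmp 0).map_eq] at h
    rw [← h, hf_def, integral_indicator_const _ hA]
    simp
  rw [hmean] at hslln
  -- Almost sure convergence on `X^∞` gives convergence in probability, which transfers to `X^n`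
  -- because the frequency depends only on the first `n` coordinates.
  have hprob := tendstoInMeasure_of_tendsto_ae (fun n => by
    refine Measurable.aestronglyMeasurable ?_
    fun_prop) hslln (ENNReal.ofReal r) (ENNReal.ofReal_pos.2 hr)
  refine hprob.congr fun n => ?_
  have hset : MeasurableSet {x : Fin n → X | r ≤ |empFreq A n x - (μ : Measure X).real A|} :=
    measurableSet_le measurable_const ((measurable_empFreq hA n).sub_const _).norm
  rw [← (measurePreserving_iidInf_iid μ n).measure_preimage hset.nullMeasurableSet]
  congr 1
  ext x
  simp only [mem_ofPred_eq, mem_preimage, edist_dist, Real.dist_eq, empFreq,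
    ENNReal.ofReal_le_ofReal_iff (abs_nonneg _), Finset.sum_range, hf_def]

/-- Two different laws can be distinguished consistently from i.i.d. samples. -/
lemma exists_consistent_test {μ ν : ProbabilityMeasure X} (h : μ ≠ ν) :
    ∃ T : (n : ℕ) → Set (Fin n → X), (∀ n, MeasurableSet (T n)) ∧
      Tendsto (fun n => (iid μ n : Measure (Fin n → X)) (T n)ᶜ) atTop (𝓝 0) ∧
      Tendsto (fun n => (iid ν n : Measure (Fin n → X)) (T n)) atTop (𝓝 0) := by
  obtain ⟨A, hA, hne⟩ : ∃ A, MeasurableSet A ∧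
      (μ : Measure X).real A ≠ (ν : Measure X).real A := by
    by_contra! hall
    refine h (Subtype.ext (Measure.ext fun A hA => ?_))
    change (μ : Measure X) A = (ν : Measure X) A
    exact (measureReal_eq_measureReal_iff).1 (hall A hA)
  set p := (μ : Measure X).real A
  set q := (ν : Measure X).real A
  -- With half the gap as threshold, a frequency close to `p` is at least that far from `q`.
  have hr : 0 < |p - q| / 2 := by have := abs_pos.2 (sub_ne_zero.2 hne); positivity
  refine ⟨fun n => {x | |empFreq A n x - p| < |p - q| / 2}, fun n => ?_, ?_, ?_⟩
  · exact measurableSet_lt ((measurable_empFreq hA n).sub_const _).norm measurable_const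
  · convert! tendsto_iid_empFreq μ hA hr using 4 with n
    ext x
    simp [p, q]
  · refine tendsto_of_tendsto_of_tendsto_of_le_of_le tendsto_const_nhds
      (tendsto_iid_empFreq ν hA hr) (fun _ => zero_le) fun n => measure_mono fun x hx => ?_
    simp only [mem_ofPred_eq] at hx ⊢
    have := abs_sub_le p (empFreq A n x) q
    rw [abs_sub_comm p (empFreq A n x)] at this
    change _ ≤ |empFreq A n x - q|
    linarith

end IID

/-! ### Two-point priors, point masses and their posteriors -/

section TwoPoint

variable {Θ : Type*} [MeasurableSpace Θ]

/-- The prior `(1 - t) δ_b + t δ_a`. -/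
noncomputable def twoPoint (a b : Θ) (t : ℝ≥0∞) (ht : t ≤ 1) : ProbabilityMeasure Θ :=
  ⟨(1 - t) • Measure.dirac b + t • Measure.dirac a,
    ⟨by simp [tsub_add_cancel_of_le ht]⟩⟩

lemma twoPoint_toMeasure (a b : Θ) (t : ℝ≥0∞) (ht : t ≤ 1) :
    (twoPoint a b t ht : Measure Θ) = (1 - t) • Measure.dirac b + t • Measure.dirac a := rfl

/-- The difference of the two measures is `t (δ_a - δ_b)`, which takes only the values `0` and `±t`.
-/
lemma tvDist_twoPoint_dirac_le (a b : Θ) {t : ℝ} (h0 : 0 ≤ t) (h1 : ENNReal.ofReal t ≤ 1) :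
    tvDist (twoPoint a b (ENNReal.ofReal t) h1) ⟨Measure.dirac b, inferInstance⟩ ≤ t := by
  have : Nonempty {A : Set Θ // MeasurableSet A} := ⟨⟨∅, .empty⟩⟩
  refine ciSup_le fun ⟨A, hA⟩ => ?_
  have ht : t ≤ 1 := by simpa using h1
  have hw : (1 - ENNReal.ofReal t).toReal = 1 - t := by
    rw [ENNReal.toReal_sub_of_le h1 ENNReal.one_ne_top, ENNReal.toReal_one,
      ENNReal.toReal_ofReal h0]
  simp only [twoPoint_toMeasure, ProbabilityMeasure.coe_mk]
  rw [measureReal_add_apply (by simp [ENNReal.mul_eq_top])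
      (by simp [ENNReal.mul_eq_top]), measureReal_ennreal_smul_apply,
    measureReal_ennreal_smul_apply, hw, ENNReal.toReal_ofReal h0]
  by_cases ha : a ∈ A <;> by_cases hb : b ∈ A <;>
    simp [measureReal_def, Measure.dirac_apply' _ hA, ha, hb, abs_of_nonneg h0, h0]

variable {X : Type*} [MeasurableSpace X] {P : Θ → ProbabilityMeasure X}

/-- Every Kullback-Leibler neighbourhood of `a` contains `a`, which is an atom of mass at least `t`.
-/
lemma twoPoint_mem_klSupport (a b : Θ) {t : ℝ≥0∞} (ht : t ≤ 1) (h0 : t ≠ 0) :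
    twoPoint a b t ht ∈ klSupport P a := by
  intro ε hε
  have ha : a ∈ klNhd P a ε := by simp [klNhd]
  rw [twoPoint_toMeasure, Measure.add_apply, Measure.smul_apply, Measure.smul_apply,
    Measure.dirac_apply_of_mem ha]
  exact (pos_iff_ne_zero.2 (by simpa using h0)).trans_le le_add_self

variable [MeasurableSingletonClass Θ]

/-- The posterior of a prior supported on two parameters concentrates on the true one. -/
lemma tendsto_post_twoPoint (b : PosteriorFamily P) {θ θ' : Θ} (hne : P θ ≠ P θ')
    {t : ℝ≥0∞} (ht : t ≤ 1) (h0 : t ≠ 0) {η : ℝ≥0∞} (hη : η ≠ 0) (hη' : η ≠ ∞) :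
    Tendsto (fun n => (iid (P θ) n : Measure (Fin n → X))
      {x | η ≤ (b.post (twoPoint θ θ' t ht) n x : Measure Θ) {θ}ᶜ}) atTop (𝓝 0) := by
  obtain ⟨T, hT, hT1, hT2⟩ := exists_consistent_test hne
  have htop : t ≠ ∞ := (ht.trans_lt ENNReal.one_lt_top).ne
  have hc : t * η ≠ 0 := mul_ne_zero h0 hη
  have hlim : Tendsto (fun n => (iid (P θ) n : Measure (Fin n → X)) (T n)ᶜ +
      (iid (P θ') n : Measure (Fin n → X)) (T n) / (t * η)) atTop (𝓝 0) := by
    simpa using hT1.add (ENNReal.Tendsto.div_const hT2 (Or.inr hc))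
  refine tendsto_of_tendsto_of_tendsto_of_le_of_le tendsto_const_nhds hlim
    (fun _ => zero_le) fun n => ?_
  set π := twoPoint θ θ' t ht
  set u : (Fin n → X) → ℝ≥0∞ := fun x => (b.post π n x : Measure Θ) {θ}ᶜ
  have hu : Measurable u :=
    (Measure.measurable_coe (measurableSet_singleton θ).compl).comp
      (measurable_subtype_coe.comp (b.measurable_post π n))
  -- Bayes' identity for the events `T n` and `{θ}ᶜ`: on the left, keep only the term of the atom at
  -- `θ`; on the right, only the atom at `θ'` can contribute.
  have hcond : t * ∫⁻ x in T n, u x ∂(iid (P θ) n : Measure (Fin n → X)) ≤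
      (iid (P θ') n : Measure (Fin n → X)) (T n) := by
    have h := b.isCond π n (T n) {θ}ᶜ (hT n) (measurableSet_singleton θ).compl
    rw [twoPoint_toMeasure, Measure.restrict_add, Measure.restrict_smul, Measure.restrict_smul,
      lintegral_add_measure, lintegral_add_measure, lintegral_smul_measure,
      lintegral_smul_measure, lintegral_smul_measure, lintegral_smul_measure,
      lintegral_dirac, lintegral_dirac] at h
    have hz : ∫⁻ θ₁ in {θ}ᶜ, (iid (P θ₁) n : Measure (Fin n → X)) (T n) ∂Measure.dirac θ = 0 := by
      classical
      rw [setLIntegral_dirac]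
      simp
    rw [hz, smul_zero, add_zero] at h
    calc _ ≤ _ := le_add_self
      _ = _ := h
      _ ≤ 1 * ∫⁻ θ₁, (iid (P θ₁) n : Measure (Fin n → X)) (T n) ∂Measure.dirac θ' :=
        mul_le_mul' tsub_le_self (setLIntegral_le_lintegral _ _)
      _ = _ := by rw [one_mul, lintegral_dirac]
  -- Markov's inequality on `T n` bounds the bad event there; off `T n` the test error suffices.
  have hmarkov := mul_meas_ge_le_lintegral₀
    (μ := (iid (P θ) n : Measure (Fin n → X)).restrict (T n)) hu.aemeasurable η
  rw [Measure.restrict_apply (measurableSet_le measurable_const hu)] at hmarkov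
  calc (iid (P θ) n : Measure (Fin n → X)) {x | η ≤ u x}
      ≤ (iid (P θ) n : Measure (Fin n → X)) ((T n)ᶜ ∪ {x | η ≤ u x} ∩ T n) :=
        measure_mono fun x hx => by by_cases hxT : x ∈ T n <;> simp_all
    _ ≤ _ := measure_union_le _ _
    _ ≤ _ := by
      gcongr
      rw [ENNReal.le_div_iff_mul_le (Or.inl hc) (Or.inl (ENNReal.mul_ne_top htop hη')), mul_comm,
        mul_assoc]
      exact (mul_le_mul_right hmarkov t).trans hcond

/-- The posterior of a point mass is that point mass. -/
lemma post_dirac (b : PosteriorFamily P) (θ θ' : Θ) (n : ℕ) :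
    ∀ᵐ x ∂(iid (P θ) n : Measure (Fin n → X)),
      (b.post ⟨Measure.dirac θ', inferInstance⟩ n x : Measure Θ) {θ'}ᶜ = 0 := by
  -- The conditional distribution is determined only up to null sets of `(P θ')^n`, but the sample
  -- follows `(P θ)^n`; absolute continuity with respect to the prior covers these samples.
  filter_upwards [b.absolutelyContinuous ⟨Measure.dirac θ', inferInstance⟩ n θ] with x hx
  exact hx (by simp)

end TwoPoint

/-! ### Lower bounds for the Prokhorov and Ky Fan distances -/

/-- A measure with more than `c` of its mass at `a` has Prokhorov distance at least `c` from the
point mass at `b`, if `b` is further than `c` from `a`. -/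
lemma le_levyProkhorovEDist_of_singleton {S : Type*} [PseudoEMetricSpace S] [MeasurableSpace S]
    [MeasurableSingletonClass S] {μ ν : Measure S} {a b : S} {c : ℝ≥0∞} (hν : ν {b}ᶜ = 0)
    (hab : c < edist a b) (hμ : c < μ {a}) : c ≤ levyProkhorovEDist μ ν := by
  by_contra! hlt
  have h := left_measure_le_of_levyProkhorovEDist_lt hlt (measurableSet_singleton a)
  -- The `c`-thickening of `{a}` misses `b`, so it is `ν`-null, and the Prokhorov inequality would
  -- force `μ {a} ≤ c`.
  have hsub : Metric.thickening c.toReal {a} ⊆ {b}ᶜ := by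
    rintro y hy rfl
    rw [Metric.mem_thickening_iff_infEDist_lt, Metric.infEDist_singleton,
      ENNReal.ofReal_toReal hab.ne_top, edist_comm] at hy
    exact hab.not_gt hy
  rw [measure_mono_null hsub hν, zero_add] at h
  exact hμ.not_ge h

/-- Two random measures at Ky Fan distance less than `ε` are within Prokhorov distance `r` off an
event of probability at most `r`, for some `r < ε`. -/
lemma exists_of_kyFanDist_lt {Θ X : Type*} [MetricSpace Θ] [MeasurableSpace Θ]
    [MeasurableSpace X] {μ : ProbabilityMeasure X} {Z W : (ℕ → X) → ProbabilityMeasure Θ}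
    {ε : ℝ} (h : kyFanDist μ Z W < ε) :
    ∃ r, 0 ≤ r ∧ r < ε ∧
      (iidInf μ : Measure (ℕ → X)) {x | r < prokhorovDist (Z x) (W x)} ≤ ENNReal.ofReal r := by
  obtain ⟨r, ⟨hr0, hr⟩, hlt⟩ := exists_lt_of_csInf_lt (s := {ε : ℝ | 0 ≤ ε ∧
    (iidInf μ : Measure (ℕ → X)) {x | ε < prokhorovDist (Z x) (W x)} ≤ ENNReal.ofReal ε})
    ⟨1, zero_le_one, by simpa using prob_le_one⟩ h
  exact ⟨r, hr0, hlt, hr⟩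

/-! ### Failure of robustness -/

/-- If `θ'` is further than `ε` from `θ`, then a small amount of prior mass at `θ` makes a difference
of at least `ε` to the limiting posterior of the point mass at `θ'`. -/
lemma not_robustAt_of_lt_edist {Θ X : Type*} [MetricSpace Θ] [MeasurableSpace Θ]
    [MeasurableSingletonClass Θ] [MeasurableSpace X] {P : Θ → ProbabilityMeasure X}
    (hinj : Function.Injective P) (b : PosteriorFamily P)
    {dData : ProbabilityMeasure X → ProbabilityMeasure X → ℝ} (hdData : ∀ μ, dData μ μ = 0)
    (dLaw : ProbabilityMeasure (ProbabilityMeasure Θ) →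
      ProbabilityMeasure (ProbabilityMeasure Θ) → ℝ)
    {θ θ' : Θ} {ρ ε₁ ε₂ δ₁ δ₂ : ℝ} (hρ : 0 < ρ) (hδ₁ : 0 < δ₁) (hδ₂ : 0 < δ₂)
    (hε : ENNReal.ofReal ε₂ < edist θ θ') (hε1 : ENNReal.ofReal ε₂ < 1) :
    ¬ RobustAt b tvDist dData dLaw kyFanDist (admissible P θ ρ) ε₁ ε₂ δ₁ δ₂ := by
  intro hrob
  have hne : P θ ≠ P θ' := hinj.ne (edist_pos.1 (hε.trans_le' zero_le))
  -- Below `ρ` for admissibility, below `δ₁` for the robustness hypothesis, below `1` for a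
  -- probability measure.
  obtain ⟨t, ht0, ht⟩ := exists_between (lt_min (lt_min hρ hδ₁) one_pos)
  obtain ⟨⟨htρ, htδ⟩, ht1⟩ : (t < ρ ∧ t < δ₁) ∧ t < 1 := by simpa using ht
  have ht1' : ENNReal.ofReal t ≤ 1 := by simpa using ht1.le
  have ht0' : ENNReal.ofReal t ≠ 0 := by simpa using ht0
  set π := twoPoint θ θ' (ENNReal.ofReal t) ht1'
  have htv := tvDist_twoPoint_dirac_le θ θ' ht0.le ht1'
  have hη : 1 - ENNReal.ofReal ε₂ ≠ 0 := (tsub_pos_of_lt hε1).ne'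
  have hbad := (tendsto_post_twoPoint b hne ht1' ht0' hη
    (ENNReal.sub_ne_top ENNReal.one_ne_top)).eventually_lt_const (tsub_pos_of_lt hε1)
  obtain ⟨n, hn, -, hky⟩ := (hbad.and (hrob π (P θ) ⟨Measure.dirac θ', inferInstance⟩ (P θ)
    ⟨twoPoint_mem_klSupport θ θ' ht1' ht0', htv.trans_lt htρ, rfl, rfl⟩ (htv.trans_lt htδ)
    (by rwa [hdData]))).exists
  obtain ⟨r, hr0, hr, hle⟩ := exists_of_kyFanDist_lt hky
  set S : Set (Fin n → X) := {x | 1 - ENNReal.ofReal ε₂ ≤ (b.post π n x : Measure Θ) {θ}ᶜ}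
  have hmp := measurePreserving_iidInf_iid (P θ) n
  -- Almost surely, either the posterior of `π` has mass at least `1 - ε₂` off `θ`, or it has mass
  -- more than `ε₂` at `θ` and so lies at Prokhorov distance at least `ε₂ > r` from `δ_θ'`. The two
  -- probabilities then sum to less than `ε₂ + (1 - ε₂)`.
  have hcover : (1 : ℝ≥0∞) ≤ (iidInf (P θ) : Measure (ℕ → X))
      ({x | r < prokhorovDist (b.rv π n x) (b.rv ⟨Measure.dirac θ', inferInstance⟩ n x)} ∪
        (fun (x : ℕ → X) (i : Fin n) => x i) ⁻¹' S) := by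
    rw [← measure_univ (μ := (iidInf (P θ) : Measure (ℕ → X)))]
    refine measure_mono_ae ?_
    filter_upwards [hmp.quasiMeasurePreserving.ae (post_dirac b θ θ' n)] with x hx _
    by_cases hxS : (fun i : Fin n => x i) ∈ S
    · exact Or.inr hxS
    refine Or.inl (hr.trans_le ?_)
    have hmass : ENNReal.ofReal ε₂ < (b.rv π n x : Measure Θ) {θ} := by
      have hxS' : (b.rv π n x : Measure Θ) {θ}ᶜ < 1 - ENNReal.ofReal ε₂ := not_le.1 hxS
      rw [prob_compl_eq_one_sub (measurableSet_singleton θ)] at hxS'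
      by_contra! hcon
      exact hxS'.not_ge (tsub_le_tsub_left hcon 1)
    have := le_levyProkhorovEDist_of_singleton (ν := (b.rv _ n x : Measure Θ)) hx hε hmass
    exact (ENNReal.ofReal_le_iff_le_toReal (levyProkhorovEDist_ne_top _ _)).1 this
  have hSm : (iidInf (P θ) : Measure (ℕ → X)) ((fun (x : ℕ → X) (i : Fin n) => x i) ⁻¹' S) <
      1 - ENNReal.ofReal ε₂ := (hmp.measure_preimage_le S).trans_lt hn
  have : (1 : ℝ≥0∞) < 1 := calc
    1 ≤ _ := hcover
    _ ≤ _ := measure_union_le _ _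
    _ < ENNReal.ofReal ε₂ + (1 - ENNReal.ofReal ε₂) :=
      ENNReal.add_lt_add_of_le_of_lt (ne_top_of_le_ne_top ENNReal.ofReal_ne_top hle)
        (hle.trans (ENNReal.ofReal_le_ofReal hr.le)) hSm
    _ = 1 := add_tsub_cancel_of_le hε1.le
  exact this.false

/-- Every point of a set lies further than any given `c` less than half the diameter from some other
point of the set. -/
lemma exists_lt_edist_of_lt_ediam_div_two {E : Type*} [PseudoEMetricSpace E] {s : Set E}
    (x : s) {c : ℝ≥0∞} (hc : c < Metric.ediam s / 2) : ∃ y : s, c < edist x y := by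
  by_contra! h
  -- Otherwise the set lies in the closed ball of radius `c` about `x`, and its diameter is at most
  -- `2c`.
  refine (ENNReal.mul_lt_of_lt_div hc).not_ge (Metric.ediam_le fun y hy z hz => ?_)
  calc edist y z ≤ edist y x + edist (x : E) z := edist_triangle _ _ _
    _ ≤ c + c := add_le_add (by rw [edist_comm]; exact h ⟨y, hy⟩) (h ⟨z, hz⟩)
    _ = c * 2 := (mul_two c).symm

end BayesRobust

theorem theorem4p1 {E F : Type*}
    [MetricSpace E] [PolishSpace E] [MeasurableSpace E] [BorelSpace E]
    [MetricSpace F] [PolishSpace F] [MeasurableSpace F] [BorelSpace F]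
    (Θ : Set E) (hΘ : MeasurableSet Θ) (hΘ₂ : Θ.Nontrivial)
    (X : Set F) (hX : MeasurableSet X)
    (P : Θ → ProbabilityMeasure X) (hP : Measurable P) (hinj : Function.Injective P)
    (hdom : BayesRobust.IsDominated P) (hopen : IsOpenMap (Set.rangeFactorization P))
    (b : BayesRobust.PosteriorFamily P)
    (dData : ProbabilityMeasure X → ProbabilityMeasure X → ℝ)
    (hdData : BayesRobust.IsPseudometric dData)
    (dLaw : ProbabilityMeasure (ProbabilityMeasure Θ) →
      ProbabilityMeasure (ProbabilityMeasure Θ) → ℝ)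
    (hdLaw : BayesRobust.IsPseudometric dLaw) :
    ∀ (θ : Θ) (ρ : ℝ), 0 < ρ →
      (¬ BayesRobust.QualitativelyRobust b BayesRobust.tvDist dData dLaw BayesRobust.kyFanDist
        (BayesRobust.admissible P θ ρ)) ∧
      ∀ ε₁ ε₂ : ℝ, ENNReal.ofReal ε₂ < min (Metric.ediam Θ / 2) 1 →
        ¬ ∃ δ₁ δ₂ : ℝ, 0 < δ₁ ∧ 0 < δ₂ ∧
          BayesRobust.RobustAt b BayesRobust.tvDist dData dLaw BayesRobust.kyFanDist
            (BayesRobust.admissible P θ ρ) ε₁ ε₂ δ₁ δ₂ := by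
  intro θ ρ hρ
  have key : ∀ ε₁ ε₂ : ℝ, ENNReal.ofReal ε₂ < min (Metric.ediam Θ / 2) 1 →
      ¬ ∃ δ₁ δ₂ : ℝ, 0 < δ₁ ∧ 0 < δ₂ ∧
        BayesRobust.RobustAt b BayesRobust.tvDist dData dLaw BayesRobust.kyFanDist
          (BayesRobust.admissible P θ ρ) ε₁ ε₂ δ₁ δ₂ := by
    rintro ε₁ ε₂ hε ⟨δ₁, δ₂, hδ₁, hδ₂, hrob⟩
    obtain ⟨θ', hθ'⟩ :=
      BayesRobust.exists_lt_edist_of_lt_ediam_div_two θ (hε.trans_le (min_le_left _ _))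
    exact BayesRobust.not_robustAt_of_lt_edist hinj b hdData.self dLaw hρ hδ₁ hδ₂ hθ'
      (hε.trans_le (min_le_right _ _)) hrob
  refine ⟨fun h => ?_, key⟩
  -- Two distinct parameters make the diameter positive, so some positive `ε₂` lies in the range
  -- where robustness fails.
  have hpos : 0 < min (Metric.ediam Θ / 2) 1 :=
    lt_min (ENNReal.half_pos (Metric.ediam_pos_iff.2 hΘ₂).ne') one_pos
  obtain ⟨ε, hε0, hε⟩ := ENNReal.lt_iff_exists_real_btwn.1 hpos
  exact key 1 ε hε.2 (h 1 ε one_pos (ENNReal.ofReal_pos.1 hε.1))
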